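/- **Definitions.** Let $K/k$ be an extension of fields. Let $\mathbf P_{K/k}$ be the set of valuation rings $O$ of $K$ containing $k$ ($O=K$ included), with the coarsest topology in which $\{O : f\in O\}$ is open for every $f\in K$. For a subset $A\subseteq K$ put $\mathbf P_{K/k}\{A\}=\{O : A\subseteq O\}$. A (ungraded) *birational space* over $k$ with field $K$ is a non-empty, connected, quasi-compact, quasi-separated topological space $X$ together with a local homeomorphism $X\to\mathbf P_{K/k}$. It is *affine* if $X\to \mathbf P_{K/k}$ is injective with image $\mathbf P_{K/k}\{A\}$ for some finitely generated $k$-subalgebra $A\subseteq K$. Let $\mathcal X$ be an integral $k$-scheme of finite type and $\eta:\operatorname{Spec}K\to\mathcal X$ a $k$-morphism whose image is the generic point. Attach to it the set of pairs $(O,x)$ with $O\in\mathbf P_{K/k}$ and $x\in\mathcal X$ such that $O$ dominates the local ring $\mathcal O_{\mathcal X,x}\subseteq K$, with the coarsest topology making $(O,x)\mapsto O$ and $(O,x)\mapsto x$ continuous. (For separated $\mathcal X$ this is the open subset of $\mathbf P_{K/k}$ of the valuation rings that dominate the local ring of a point of $\mathcal X$; in general it is obtained by gluing these over the separated opens of $\mathcal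 X$.) The morphism $\eta$ is a *pointed integral scheme model* of a birational space $X\to\mathbf P_{K/k}$ if this set of pairs is homeomorphic to $X$ over $\mathbf P_{K/k}$. **Theorem.** Let $k$ be a field. 1. Let $K/k$ be a field extension, $X\to\mathbf P_{K/k}$ a birational space over $k$, and $\eta:\operatorname{Spec}K\to\mathcal X$ a pointed integral scheme model of it. Then the birational space is affine if and only if the normalization of $\mathcal X$ is proper over an affine $k$-scheme of finite type (that is, admits a proper $k$-morphism to such a scheme). 2. Let $S$ and $S'$ be irreducible and reduced $k$-schemes of finite type, and let $\pi:S'\to S$ be a proper surjective $k$-morphism. Then the normalization of $S'$ is proper over an affine $k$-scheme of finite type if and only if the normalization of $S$ is. -/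

import Mathlib

open CategoryTheory AlgebraicGeometry

universe u v

/-- The Riemann-Zariski space `P_{K/k}`: the set of valuation rings of `K` containing `k`
(the trivial valuation ring `K` included). -/
def RiemannZariski (k K : Type u) [Field k] [Field K] [Algebra k K] : Type u :=
  {O : ValuationSubring K // ∀ a : k, algebraMap k K a ∈ O}

namespace RiemannZariski

variable {k K : Type u} [Field k] [Field K] [Algebra k K]

/-- The valuation ring of `K` underlying a point of `P_{K/k}`. -/
def ring (p : RiemannZariski k K) : ValuationSubring K := p.1

/-- The subset `P_{K/k}{S}` of all valuation rings containing `S`. -/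
def containing (k : Type u) {K : Type u} [Field k] [Field K] [Algebra k K] (S : Set K) :
    Set (RiemannZariski k K) :=
  {p | ∀ f ∈ S, f ∈ p.ring}

/-- The topology of `P_{K/k}` is the coarsest one in which all `P_{K/k}{f}`, `f ∈ K`, are open. -/
instance : TopologicalSpace (RiemannZariski k K) :=
  TopologicalSpace.generateFrom {U | ∃ f : K, U = containing k {f}}

/-- The affine subsets of `P_{K/k}`: the sets `P_{K/k}{A}` for a finitely generated
`k`-subalgebra `A` of `K`. -/
def IsAffineSubset (U : Set (RiemannZariski k K)) : Prop :=
  ∃ A : Subalgebra k K, A.FG ∧ U = containing k (A : Set K)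

end RiemannZariski

/-- An (ungraded) birational space over `k`, with field `K`: a non-empty, connected, quasi-compact
and quasi-separated space `X` together with a local homeomorphism `X → P_{K/k}`. -/
structure BirationalSpace (k K : Type u) [Field k] [Field K] [Algebra k K] where
  /-- The underlying space. -/
  carrier : Type v
  [topology : TopologicalSpace carrier]
  /-- The map to `P_{K/k}`. -/
  toRZ : carrier → RiemannZariski k K
  nonempty : Nonempty carrier
  connected : ConnectedSpace carrier
  quasiCompact : CompactSpace carrier
  quasiSeparated : QuasiSeparatedSpace carrier
  isLocalHomeomorph : IsLocalHomeomorph toRZ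

attribute [instance] BirationalSpace.topology

/-- A birational space `X → P_{K/k}` is affine if `X` maps bijectively onto an affine subset. -/
def BirationalSpace.IsAffine {k K : Type u} [Field k] [Field K] [Algebra k K]
    (X : BirationalSpace.{u, v} k K) : Prop :=
  Function.Injective X.toRZ ∧ RiemannZariski.IsAffineSubset (Set.range X.toRZ)

/-- A pointed integral `k`-scheme: a `k`-morphism `η : Spec K ⟶ X` to an integral `k`-scheme of
finite type that hits the generic point of `X`. The field `K` may be larger than the function
field of `X`. -/
structure PointedIntegralScheme (k K : Type u) [Field k] [Field K] [Algebra k K] where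
  /-- The scheme. -/
  X : Scheme.{u}
  /-- The structure morphism. -/
  str : X ⟶ Spec (.of k)
  [isIntegral : IsIntegral X]
  [locallyOfFiniteType : LocallyOfFiniteType str]
  [quasiCompact : QuasiCompact str]
  /-- The point. -/
  η : Spec (.of K) ⟶ X
  η_str : η ≫ str = Spec.map (CommRingCat.ofHom (algebraMap k K))
  η_generic : η (IsLocalRing.closedPoint K) = genericPoint X

namespace PointedIntegralScheme

attribute [instance] isIntegral locallyOfFiniteType quasiCompact

variable {k K : Type u} [Field k] [Field K] [Algebra k K] (M : PointedIntegralScheme k K)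

/-- The embedding of the local ring at `x` into `K`:
the composition of `𝒪_{X, x} → 𝒪_{X, η} = k(X)` with the field extension `k(X) → K`. -/
noncomputable def stalkToField (x : M.X) : M.X.presheaf.stalk x →+* K :=
  (M.X.presheaf.stalkSpecializes
    (show M.η (IsLocalRing.closedPoint K) ⤳ x from
      M.η_generic.symm ▸ genericPoint_specializes x) ≫
    Scheme.stalkClosedPointTo M.η).hom

/-- The local ring of `X` at `x`, as a local subring of `K`. -/
noncomputable def localSubring (x : M.X) : LocalSubring K :=
  LocalSubring.range (M.stalkToField x)

/-- The space attached to `η : Spec K ⟶ X`: the pairs consisting of a valuation ring `O` of `K`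
containing `k` and a point `x` of `X` such that `O` dominates the local ring of `x`
(`≤` on local subrings is domination). If `X` is separated, `x` is determined by `O`. -/
def Space : Type u :=
  {p : RiemannZariski k K × M.X // M.localSubring p.2 ≤ p.1.ring.toLocalSubring}

/-- The glued topology: the coarsest one in which the pairs lying over an open subset of `P_{K/k}`
and the pairs lying over an open subset of `X` are open. For a separated open `U` of `X` the
pairs with `x ∈ U` form an open subset, which is mapped homeomorphically onto an open subset of
`P_{K/k}` (for affine `U` this is `P_{K/k}{𝒪(U)}`); so this is the space obtained by gluing these
open subsets of `P_{K/k}` along the intersections of the separated opens. -/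
instance : TopologicalSpace M.Space :=
  inferInstanceAs (TopologicalSpace
    {p : RiemannZariski k K × M.X // M.localSubring p.2 ≤ p.1.ring.toLocalSubring})

/-- The projection of the attached space to `P_{K/k}`. -/
def toRZ (p : M.Space) : RiemannZariski k K := p.1.1

/-- `η : Spec K ⟶ X` is a pointed integral scheme model of the birational space `B` if the space
over `P_{K/k}` attached to it is isomorphic to `B`. -/
def IsModelOf (B : BirationalSpace.{u, v} k K) : Prop :=
  ∃ e : M.Space ≃ₜ B.carrier, ∀ p, B.toRZ (e p) = M.toRZ p

end PointedIntegralScheme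

instance AlgebraicGeometry.Scheme.quasiCompact_fromSpecStalk_genericPoint
    (X : Scheme.{u}) [IsIntegral X] : QuasiCompact (X.fromSpecStalk (genericPoint X)) where
  isCompact_preimage U _ _ := by
    have : Finite (Spec (X.presheaf.stalk (genericPoint X))) :=
      inferInstanceAs (Finite (PrimeSpectrum X.functionField))
    exact (Set.toFinite _).isCompact

namespace AlgebraicGeometry.Scheme

/-- The normalization of an integral scheme `X`: the relative normalization of `X` in its generic
point `Spec k(X) ⟶ X`, i.e. over an affine open `U` it is `Spec` of the integral closure of
`𝒪(U)` in the function field. -/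
noncomputable def integralNormalization (X : Scheme.{u}) [IsIntegral X] : Scheme.{u} :=
  (X.fromSpecStalk (genericPoint X)).normalization

/-- The normalization morphism. -/
noncomputable def integralNormalizationMap (X : Scheme.{u}) [IsIntegral X] :
    X.integralNormalization ⟶ X :=
  (X.fromSpecStalk (genericPoint X)).fromNormalization

end AlgebraicGeometry.Scheme

/-- The `k`-scheme `f : Z ⟶ Spec k` is proper over an affine `k`-scheme of finite type. -/
def IsProperOverAffine {k : Type u} [Field k] {Z : Scheme.{u}} (f : Z ⟶ Spec (.of k)) : Prop :=
  ∃ (Y : Scheme.{u}) (str : Y ⟶ Spec (.of k)) (g : Z ⟶ Y),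
    IsAffine Y ∧ LocallyOfFiniteType str ∧ QuasiCompact str ∧ IsProper g ∧ g ≫ str = f

/-! Everything is read off from lifts of the `K`-point `η` to morphisms from `Spec O`, for `O` a
valuation ring of `K`. A point of the attached space over `O` is the same as such a lift
(`PointedIntegralScheme.localSubring_le_iff`), so affineness means: each `O` has at most one lift,
and it has one exactly when `O` contains a fixed finitely generated algebra `A`. This is
`HasAffineValuations`. A morphism satisfying the valuative criterion induces bijections on lifts, so
the condition is invariant under proper morphisms (`hasAffineValuations_comp_iff`). This gives part
2 once part 1 is known, and it allows passing to the normalization `N`, which is finite by Noether's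
theorem (`Algebra.FiniteType.finite_integralClosure`).

If `N` is proper over an affine `Y`, the condition reduces to `Y`, where `A` is the image of the
sections in `K`. Conversely, each generator `a` of `A` lies in every valuation ring with a center,
hence is integral over the sections on every affine open. The coefficients of its minimal polynomial
over the function field are then global sections of `N`; the minimal polynomial is needed because
`K` may be larger than the function field. These coefficients generate an algebra `B`. A valuation
ring containing the image of `B` contains each `a`, being integrally closed, and so has a unique
lift to `N`. Thus `N → Spec B` satisfies the valuative criterion for lifts of the generic point, and
composite valuations extend this to the full criterion (`ValuativeCriterion.of_generic`). -/

/-! ### Separability after extracting `p`-power roots. -/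

section SeparableExtensions

open Polynomial

/-- Every finite subset of a field gets all its `q`-th roots in a finite extension. -/
lemma exists_finiteDimensional_forall_exists_pow_eq {k : Type u} [Field k] (S : Finset k) {q : ℕ}
    (hq : q ≠ 0) :
    ∃ (k' : Type u) (_ : Field k') (_ : Algebra k k'), FiniteDimensional k k' ∧
      ∀ c ∈ S, ∃ d : k', d ^ q = algebraMap k k' c := by
  choose d hd using fun c : k ↦
    IsAlgClosed.exists_pow_nat_eq (algebraMap k (AlgebraicClosure k) c) hq.bot_lt
  have : Finite (d '' (S : Set k)) := (S.finite_toSet.image _).to_subtype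
  refine ⟨IntermediateField.adjoin k (d '' (S : Set k)), inferInstance, inferInstance,
    IntermediateField.finiteDimensional_adjoin fun x _ ↦ Algebra.IsIntegral.isIntegral x,
    fun c hc ↦ ⟨⟨d c, IntermediateField.subset_adjoin k _ ⟨c, hc, rfl⟩⟩, Subtype.ext (hd c)⟩⟩

/-- If `h` is obtained from a separable polynomial `g` by extracting `p ^ e`-th roots of the
coefficients, every `p ^ e`-th root of a root of `g` is separable. -/
lemma isSeparable_of_pow_of_forall_coeff_exists_pow {F F' Ω : Type*} [Field F] [Field F'] [Field Ω]
    [Algebra F F'] [Algebra F' Ω] [Algebra F Ω] [IsScalarTower F F' Ω] (p e : ℕ) [ExpChar F' p]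
    {g : F[X]} (hg : g.Separable)
    (hroot : ∀ i, ∃ d : F', d ^ p ^ e = algebraMap F F' (g.coeff i)) (x : Ω)
    (hx : aeval (x ^ p ^ e) g = 0) : IsSeparable F' x := by
  choose d hd using hroot
  have hp : p ^ e ≠ 0 := pow_ne_zero _ (expChar_ne_zero F' p)
  let h : F'[X] := ∑ i ∈ g.support, monomial i (d i)
  -- Frobenius carries `h` to `g`. Separability is insensitive to field maps, so it descends to `h`;
  -- moreover `h(x) ^ p ^ e = g(x ^ p ^ e) = 0`.
  have hh : h.map (iterateFrobenius F' p e) = g.map (algebraMap F F') := by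
    ext i
    simp only [h, coeff_map, finsetSum_coeff, coeff_monomial, Finset.sum_ite_eq',
      mem_support_iff, ne_eq]
    split_ifs with hi
    · rw [iterateFrobenius_def, hd]
    · simp [notMem_support_iff.mp hi]
  have hsep : h.Separable := by
    rw [← separable_map (iterateFrobenius F' p e), hh, separable_map]
    exact hg
  have hzero : aeval x h = 0 := by
    have : (aeval x h) ^ p ^ e = 0 := by
      rw [← map_pow, ← map_iterateFrobenius_expand, map_expand, expand_aeval, hh,
        aeval_map_algebraMap, hx]
    exact pow_eq_zero_iff hp |>.mp this
  exact hsep.of_dvd (minpoly.dvd _ _ hzero)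

/-- Let `A ⊆ A'` be a finite extension of a Noetherian ring such that `A'` is integrally closed. If
a finite extension `L` of `Frac A` becomes separable over `Frac A'`, the integral closure of `A`
in `L` is finite. -/
lemma isNoetherian_integralClosure_of_isSeparable_adjoin {A A' F F' L Ω : Type*}
    [CommRing A] [IsNoetherianRing A] [CommRing A'] [IsDomain A']
    [IsIntegrallyClosed A'] [Field F] [Field F'] [Field L] [Field Ω]
    [Algebra A A'] [Module.Finite A A']
    [Algebra A F] [Algebra A' F'] [IsFractionRing A' F']
    [Algebra F F'] [Algebra A F'] [IsScalarTower A F F'] [IsScalarTower A A' F']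
    [Algebra F L] [Algebra A L] [IsScalarTower A F L]
    [Algebra F' Ω] [Algebra F Ω] [IsScalarTower F F' Ω]
    (φ : L →ₐ[F] Ω) (s : Finset L) (hs : IntermediateField.adjoin F (s : Set L) = ⊤)
    (hsep : ∀ l ∈ s, IsSeparable F' (φ l)) : IsNoetherian A (integralClosure A L) := by
  classical
  let E : IntermediateField F' Ω := IntermediateField.adjoin F' (φ '' (s : Set L))
  have : Algebra.IsSeparable F' E := by
    rw [IntermediateField.isSeparable_adjoin_iff_isSeparable]
    rintro _ ⟨l, hl, rfl⟩
    exact hsep l hl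
  have : FiniteDimensional F' E := by
    have : Finite (φ '' (s : Set L)) := (s.finite_toSet.image _).to_subtype
    refine IntermediateField.finiteDimensional_adjoin ?_
    rintro _ ⟨l, hl, rfl⟩
    exact (hsep l hl).isIntegral
  have hE : ∀ l, φ l ∈ E := by
    intro l
    have hl : l ∈ IntermediateField.adjoin F (s : Set L) := hs ▸ IntermediateField.mem_top
    have : IntermediateField.adjoin F (s : Set L) ≤ (E.restrictScalars F).comap φ := by
      rw [IntermediateField.adjoin_le_iff]
      intro a ha
      exact IntermediateField.subset_adjoin F' _ ⟨a, ha, rfl⟩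
    exact this hl
  let : Algebra A' E := ((algebraMap F' E).comp (algebraMap A' F')).toAlgebra
  have : IsScalarTower A' F' E := .of_algebraMap_eq' rfl
  let : Algebra A E := ((algebraMap F' E).comp (algebraMap A F')).toAlgebra
  have : IsScalarTower A A' E := .of_algebraMap_eq' <| by
    change (algebraMap F' E).comp _ = ((algebraMap F' E).comp _).comp _
    rw [RingHom.comp_assoc, ← IsScalarTower.algebraMap_eq A A' F']
  let C := integralClosure A' E
  have : IsNoetherianRing A' := isNoetherian_of_isNoetherianRing_of_finite A A' |> fun h ↦
    isNoetherianRing_iff.mpr (isNoetherian_of_tower A h)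
  -- The classical separable case, which uses that `A'` is integrally closed and `E` is separable
  -- over `F'`. The closure of `A` in `L` then embeds into `C`.
  have : IsNoetherian A' C := IsIntegralClosure.isNoetherian A' F' E C
  have : Module.Finite A' C := Module.IsNoetherian.finite A' C
  have : Module.Finite A C := .trans A' C
  have : IsNoetherian A C := isNoetherian_of_isNoetherianRing_of_finite A C
  let ψ : L →+* E := φ.toRingHom.codRestrict E.toSubfield hE
  have hψ : ψ.comp (algebraMap A L) = algebraMap A E := by
    ext a
    change φ (algebraMap A L a) = algebraMap F' Ω (algebraMap A F' a)
    rw [IsScalarTower.algebraMap_apply A F L, φ.commutes, IsScalarTower.algebraMap_apply A F F',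
      ← IsScalarTower.algebraMap_apply F F' Ω]
  let ψ' : L →ₐ[A] E := { ψ with commutes' := fun a ↦ congr($hψ a) }
  let θ : integralClosure A L →ₗ[A] C :=
    { toFun x := ⟨ψ' x, (x.2.map ψ').tower_top⟩
      map_add' x y := Subtype.ext (map_add ψ' _ _)
      map_smul' a x := Subtype.ext (map_smul ψ' a x.1) }
  refine isNoetherian_of_injective θ fun x y h ↦ Subtype.ext (ψ.injective congr(($h).1))

end SeparableExtensions

/-! ### Noether's finiteness theorem for domains of finite type over a field. -/

section FinitenessOfNormalization

/-- A polynomial all of whose coefficients become `p ^ e`-th powers in `k'` becomes a `p ^ e`-th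
power in `k'[X^{1 / p ^ e}]`. -/
lemma MvPolynomial.exists_pow_eq_expand_map {σ k k' : Type*} [Field k] [Field k'] [Algebra k k']
    (p e : ℕ) [ExpChar k' p] (f : MvPolynomial σ k)
    (h : ∀ m ∈ f.support, ∃ d : k', d ^ p ^ e = algebraMap k k' (f.coeff m)) :
    ∃ g : MvPolynomial σ k', g ^ p ^ e = expand (p ^ e) (map (algebraMap k k') f) := by
  choose! d hd using h
  refine ⟨∑ m ∈ f.support, monomial m (d m), ?_⟩
  rw [← map_iterateFrobenius_expand, map_expand]
  congr 1
  conv_rhs => rw [f.as_sum]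
  simp only [map_sum, map_monomial, iterateFrobenius_def]
  exact Finset.sum_congr rfl fun m hm ↦ by rw [hd m hm]

/-- The extension `k[X] → k'[X^{1 / q}]` is finite. -/
lemma MvPolynomial.finite_expand_comp_map {σ k k' : Type*} [Finite σ] [Field k] [Field k']
    [Algebra k k'] [FiniteDimensional k k'] {q : ℕ} (hq : q ≠ 0) :
    (((expand q).toRingHom.comp (map (algebraMap k k'))) :
      MvPolynomial σ k →+* MvPolynomial σ k').Finite := by
  set φ : MvPolynomial σ k →+* MvPolynomial σ k' :=
    (expand q).toRingHom.comp (map (algebraMap k k')) with hφ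
  have hφX (i : σ) : φ (X i) = X i ^ q := by simp [hφ]
  have hφC (a : k) : φ (C a) = C (algebraMap k k' a) := by simp [hφ]
  have hint : φ.IsIntegral := by
    intro f
    induction f using MvPolynomial.induction_on with
    | C a =>
      obtain ⟨g, hg, hg0⟩ := Algebra.IsIntegral.isIntegral (R := k) a
      refine ⟨g.map C, hg.map _, ?_⟩
      have : φ.comp C = C.comp (algebraMap k k') := RingHom.ext hφC
      rw [Polynomial.eval₂_map, this, ← Polynomial.hom_eval₂, hg0, map_zero]
    | add f g hf hg => exact hf.add φ hg
    | mul_X f i hf =>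
      refine hf.mul φ ⟨Polynomial.X ^ q - Polynomial.C (X i), Polynomial.monic_X_pow_sub_C _ hq, ?_⟩
      simp [hφX]
  have hft : φ.FiniteType := by
    have : (φ.comp C).FiniteType := by
      rw [show φ.comp C = C.comp (algebraMap k k') from RingHom.ext hφC]
      refine RingHom.FiniteType.comp ?_ (RingHom.Finite.finiteType ?_)
      · rw [← algebraMap_eq]
        exact (RingHom.finiteType_algebraMap).mpr inferInstance
      · exact (RingHom.finite_algebraMap).mpr inferInstance
    exact this.of_comp_finiteType
  exact RingHom.IsIntegral.to_finite hint hft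

/-- Noether's finiteness theorem for polynomial rings. -/
lemma MvPolynomial.isNoetherian_integralClosure {k : Type u} [Field k] {n : ℕ} (F L : Type*)
    [Field F] [Algebra (MvPolynomial (Fin n) k) F] [IsFractionRing (MvPolynomial (Fin n) k) F]
    [Field L] [Algebra F L] [FiniteDimensional F L] [Algebra (MvPolynomial (Fin n) k) L]
    [IsScalarTower (MvPolynomial (Fin n) k) F L] :
    IsNoetherian (MvPolynomial (Fin n) k) (integralClosure (MvPolynomial (Fin n) k) L) := by
  classical
  obtain ⟨p, hp⟩ := ExpChar.exists k
  have : ExpChar (MvPolynomial (Fin n) k) p := expChar_of_injective_algebraMap (C_injective _ k) p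
  have : ExpChar F p :=
    expChar_of_injective_algebraMap (IsFractionRing.injective (MvPolynomial (Fin n) k) F) p
  have : ExpChar (separableClosure F L) p :=
    expChar_of_injective_algebraMap (algebraMap F (separableClosure F L)).injective p
  -- `L` is purely inseparable of finite exponent over the separable closure of `F`, so all `p ^
  -- e`-th powers are separable over `F`. Since `p` is the exponential characteristic,
  -- characteristic zero is covered with `p = 1`.
  set e := IsPurelyInseparable.exponent (separableClosure F L) L
  have hp0 : p ^ e ≠ 0 := pow_ne_zero _ (expChar_ne_zero k p)
  have hsep (l : L) : IsSeparable F (l ^ p ^ e) := by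
    obtain ⟨x, hx⟩ := IsPurelyInseparable.exponent_def' (separableClosure F L) p l
    rw [← hx]
    exact x.2
  obtain ⟨s, hs⟩ := IntermediateField.fg_of_noetherian (⊤ : IntermediateField F L)
  let T : Finset F := s.biUnion fun l ↦ (minpoly F (l ^ p ^ e)).coeffs
  choose num den hden hnd using IsFractionRing.div_surjective (MvPolynomial (Fin n) k) (K := F)
  -- The finitely many constants whose `p ^ e`-th roots are needed: with these and the roots of the
  -- variables, every element of `T` becomes a `p ^ e`-th power.
  let S : Finset k := T.biUnion fun z ↦
    (num z).support.image (num z).coeff ∪ (den z).support.image (den z).coeff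
  obtain ⟨k', _, _, _, hk'⟩ := exists_finiteDimensional_forall_exists_pow_eq S hp0
  have : ExpChar k' p := expChar_of_injective_algebraMap (algebraMap k k').injective p
  -- The target plays the role of `k'[X ^ (1 / p ^ e)]`: a variable maps to the `p ^ e`-th power of
  -- the new one. It is again a polynomial ring, hence integrally closed.
  let φ : MvPolynomial (Fin n) k →+* MvPolynomial (Fin n) k' :=
    (expand (p ^ e)).toRingHom.comp (map (algebraMap k k'))
  have hφ : Function.Injective φ := (expand_injective hp0.bot_lt).comp
    (map_injective _ (algebraMap k k').injective)
  have hφfin : φ.Finite := finite_expand_comp_map hp0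
  obtain ⟨F', _, _, _⟩ : ∃ (F' : Type u) (_ : Field F') (_ : Algebra (MvPolynomial (Fin n) k') F'),
      IsFractionRing (MvPolynomial (Fin n) k') F' :=
    ⟨FractionRing (MvPolynomial (Fin n) k'), inferInstance, inferInstance, inferInstance⟩
  let : Algebra (MvPolynomial (Fin n) k) (MvPolynomial (Fin n) k') := φ.toAlgebra
  have : Module.Finite (MvPolynomial (Fin n) k) (MvPolynomial (Fin n) k') := hφfin
  let : Algebra F F' := (IsFractionRing.lift (A := MvPolynomial (Fin n) k)
    (g := (algebraMap (MvPolynomial (Fin n) k') F').comp φ)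
    ((IsFractionRing.injective (MvPolynomial (Fin n) k') F').comp hφ)).toAlgebra
  let : Algebra (MvPolynomial (Fin n) k) F' :=
    ((algebraMap (MvPolynomial (Fin n) k') F').comp φ).toAlgebra
  have : IsScalarTower (MvPolynomial (Fin n) k) (MvPolynomial (Fin n) k') F' :=
    .of_algebraMap_eq' rfl
  have : IsScalarTower (MvPolynomial (Fin n) k) F F' := .of_algebraMap_eq fun x ↦
    (IsFractionRing.lift_algebraMap (A := MvPolynomial (Fin n) k) _ x).symm
  have : ExpChar F' p := expChar_of_injective_algebraMap (algebraMap F F').injective p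
  have hpow (f : MvPolynomial (Fin n) k) (hf : ∀ m ∈ f.support, f.coeff m ∈ S) :
      ∃ g : F', g ^ p ^ e = algebraMap (MvPolynomial (Fin n) k) F' f := by
    obtain ⟨g, hg⟩ := exists_pow_eq_expand_map p e f fun m hm ↦ hk' _ (hf m hm)
    exact ⟨algebraMap _ F' g, by rw [← map_pow, hg]; rfl⟩
  have hroot (z : F) (hz : z ∈ T) : ∃ g : F', g ^ p ^ e = algebraMap F F' z := by
    obtain ⟨a, ha⟩ := hpow (num z) fun m hm ↦ Finset.mem_biUnion.mpr
      ⟨z, hz, Finset.mem_union_left _ (Finset.mem_image_of_mem _ hm)⟩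
    obtain ⟨b, hb⟩ := hpow (den z) fun m hm ↦ Finset.mem_biUnion.mpr
      ⟨z, hz, Finset.mem_union_right _ (Finset.mem_image_of_mem _ hm)⟩
    refine ⟨a / b, ?_⟩
    rw [div_pow, ha, hb, IsScalarTower.algebraMap_apply _ F F' (num z),
      IsScalarTower.algebraMap_apply _ F F' (den z), ← map_div₀, hnd]
  let Ω := AlgebraicClosure F'
  let ψ : L →ₐ[F] Ω := IsAlgClosed.lift
  refine isNoetherian_integralClosure_of_isSeparable_adjoin (A' := MvPolynomial (Fin n) k')
    (F' := F') ψ s hs fun l hl ↦ isSeparable_of_pow_of_forall_coeff_exists_pow p e (hsep l)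
      (fun i ↦ ?_) (ψ l) ?_
  · by_cases hi : (minpoly F (l ^ p ^ e)).coeff i = 0
    · exact ⟨0, by rw [hi, map_zero, zero_pow hp0]⟩
    · exact hroot _ (Finset.mem_biUnion.mpr ⟨l, hl, Polynomial.coeff_mem_coeffs hi⟩)
  · rw [← map_pow, Polynomial.aeval_algHom_apply, minpoly.aeval, map_zero]

/-- Noether's finiteness theorem: the normalization of a domain of finite type over a field is
finite. -/
theorem Algebra.FiniteType.finite_integralClosure (k : Type u) [Field k] (D L : Type*) [CommRing D]
    [IsDomain D] [Algebra k D] [Algebra.FiniteType k D] [Field L] [Algebra D L]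
    [IsFractionRing D L] : Module.Finite D (integralClosure D L) := by
  obtain ⟨n, g, hg, hgfin⟩ := exists_finite_inj_algHom_of_fg k D
  let P := MvPolynomial (Fin n) k
  let F := FractionRing P
  let : Algebra P D := g.toRingHom.toAlgebra
  have : Module.Finite P D := hgfin
  let : Algebra P L := ((algebraMap D L).comp g.toRingHom).toAlgebra
  have : IsScalarTower P D L := .of_algebraMap_eq' rfl
  have hPL : Function.Injective ((algebraMap D L).comp g.toRingHom) :=
    (IsFractionRing.injective D L).comp hg
  let : Algebra F L := (IsFractionRing.lift (A := P) hPL).toAlgebra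
  have : IsScalarTower P F L := .of_algebraMap_eq fun x ↦
    (IsFractionRing.lift_algebraMap (A := P) hPL x).symm
  have : FaithfulSMul P D := (faithfulSMul_iff_algebraMap_injective P D).mpr hg
  have : IsLocalization (Algebra.algebraMapSubmonoid D (nonZeroDivisors P)) L := inferInstance
  have : FiniteDimensional F L := .of_isLocalization P D (nonZeroDivisors P)
  have := MvPolynomial.isNoetherian_integralClosure F L (k := k) (n := n)
  -- `D` is finite over its Noether normalization `P`, so integrality over `D` implies integrality
  -- over `P`.
  let θ : integralClosure D L →ₗ[P] integralClosure P L :=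
    { toFun x := ⟨x, isIntegral_trans (R := P) (A := D) _ x.2⟩
      map_add' _ _ := rfl
      map_smul' _ _ := rfl }
  have : IsNoetherian P (integralClosure D L) :=
    isNoetherian_of_injective θ fun x y h ↦ Subtype.ext congr(($h).1)
  have : IsNoetherian D (integralClosure D L) := isNoetherian_of_tower P this
  exact Module.IsNoetherian.finite D _

end FinitenessOfNormalization

/-! ### Composite valuation rings. -/

section CompositeValuation

open IsLocalRing

/-- The composite of a valuation ring `V` of `K` with a valuation ring `W` of its residue field. -/
def ValuationSubring.composite {K : Type*} [Field K] (V : ValuationSubring K)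
    (W : ValuationSubring (ResidueField V)) : ValuationSubring K where
  toSubring := (W.toSubring.comap (residue V)).map V.subtype
  mem_or_inv_mem' x := by
    simp only [Subsemiring.coe_carrier_toSubmonoid, Subring.coe_toSubsemiring]
    suffices H : ∀ y : V, (y : K) ∈ (W.toSubring.comap (residue V)).map V.subtype ∨
        (y : K)⁻¹ ∈ (W.toSubring.comap (residue V)).map V.subtype by
      rcases V.mem_or_inv_mem x with hx | hx
      · exact H ⟨x, hx⟩
      · simpa [or_comm] using H ⟨x⁻¹, hx⟩
    intro y
    by_cases hy : IsUnit y
    · obtain ⟨u, rfl⟩ := hy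
      rcases W.mem_or_inv_mem (residue V u) with hu | hu
      · exact .inl ⟨u, hu, rfl⟩
      · refine .inr ⟨(u⁻¹ : Vˣ), ?_, ?_⟩
        · simpa using hu
        · simp
    · refine .inl ⟨y, ?_, rfl⟩
      have : residue V y = 0 := by rwa [residue_eq_zero_iff]
      simp [this]

lemma ValuationSubring.mem_composite {K : Type*} [Field K] {V : ValuationSubring K}
    {W : ValuationSubring (ResidueField V)} {y : V} :
    (y : K) ∈ V.composite W ↔ residue V y ∈ W := by
  change (y : K) ∈ (W.toSubring.comap (residue V)).map V.subtype ↔ _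
  simp [Subring.mem_map]

lemma ValuationSubring.composite_le {K : Type*} [Field K] (V : ValuationSubring K)
    (W : ValuationSubring (ResidueField V)) : V.composite W ≤ V := by
  rintro _ ⟨y, -, rfl⟩
  exact y.2

/-- A valuation ring of the residue field of a local ring `R` at a point of a field `K` that lies
over a valuation ring `W` of another field point `K'` centered at the closed point of `R`. -/
lemma ValuationSubring.exists_forall_mem_iff {R K K' : Type*} [CommRing R] [IsLocalRing R]
    [Field K] [Field K'] (ψ : R →+* K) (φ : R →+* K') [IsLocalHom φ] (W : ValuationSubring K') :
    ∃ V V' : ValuationSubring K, V' ≤ V ∧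
      (∃ h : ∀ a, ψ a ∈ V.toSubring, IsLocalHom (ψ.codRestrict V.toSubring h)) ∧
      ∀ a, ψ a ∈ V' ↔ φ a ∈ W := by
  obtain ⟨V, hV, hloc⟩ := exists_factor_valuationRing ψ
  let ψV : R →+* V := ψ.codRestrict V.toSubring hV
  have : IsLocalHom ψV := hloc
  let ρ : ResidueField R →+* ResidueField V := ResidueField.map ψV
  let ι : ResidueField R →+* K' := ResidueField.lift φ
  let W₀ : ValuationSubring (ResidueField R) := W.comap ι
  obtain ⟨W', hW', hloc'⟩ := exists_factor_valuationRing (ρ.comp W₀.subtype)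
  -- `W'` dominates `W₀`, so it contracts to exactly `W₀`: for `x ∉ W₀` the inverse `x⁻¹` is a
  -- nonunit of `W₀` and remains one in `W'`.
  have key (x : ResidueField R) : ρ x ∈ W' ↔ x ∈ W₀ := by
    refine ⟨fun hx ↦ ?_, fun hx ↦ hW' ⟨x, hx⟩⟩
    by_contra hx0
    have hxinv : x⁻¹ ∈ W₀ := (W₀.mem_or_inv_mem x).resolve_left hx0
    have hne : x ≠ 0 := by rintro rfl; exact hx0 W₀.zero_mem
    have hu : IsUnit ((ρ.comp W₀.subtype).codRestrict W'.toSubring hW' ⟨x⁻¹, hxinv⟩) := by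
      refine IsUnit.of_mul_eq_one ⟨ρ x, hx⟩ (Subtype.ext ?_)
      change ρ x⁻¹ * ρ x = 1
      rw [← map_mul, inv_mul_cancel₀ hne, map_one]
    obtain ⟨y, hy⟩ := isUnit_iff_exists_inv.mp (hloc'.1 _ hu)
    have : y.1 = x := by
      have := congr(($hy).1)
      exact (inv_mul_eq_one₀ hne).mp this |>.symm ▸ rfl
    exact hx0 (this ▸ y.2)
  refine ⟨V, V.composite W', V.composite_le W', ⟨hV, hloc⟩, fun a ↦ ?_⟩
  change ((ψV a : V) : K) ∈ _ ↔ _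
  rw [mem_composite, ← ResidueField.map_residue, key]
  rfl

end CompositeValuation

/-! ### Morphisms from spectra of local rings. -/

namespace AlgebraicGeometry

open IsLocalRing

section LocalRings

/-- A morphism from the spectrum of a local ring is given by a local homomorphism from a stalk. -/
lemma exists_eq_SpecMap_comp_fromSpecStalk {X : Scheme.{u}} {R : CommRingCat.{u}} [IsLocalRing R]
    (g : Spec R ⟶ X) {x : X} (hx : g (closedPoint R) = x) :
    ∃ φ : X.presheaf.stalk x ⟶ R, IsLocalHom φ.hom ∧ Spec.map φ ≫ X.fromSpecStalk x = g := by
  subst hx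
  exact ⟨Scheme.stalkClosedPointTo g, inferInstance, Scheme.Spec_stalkClosedPointTo_fromSpecStalk g⟩

lemma SpecMap_comp_fromSpecStalk_injective {X : Scheme.{u}} {R : CommRingCat.{u}} {x : X}
    {φ ψ : X.presheaf.stalk x ⟶ R}
    (h : Spec.map φ ≫ X.fromSpecStalk x = Spec.map ψ ≫ X.fromSpecStalk x) : φ = ψ :=
  Spec.map_injective ((cancel_mono _).mp h)

lemma SpecMap_comp_fromSpecStalk_closedPoint {X : Scheme.{u}} {R : CommRingCat.{u}} [IsLocalRing R]
    {x : X} (φ : X.presheaf.stalk x ⟶ R) [IsLocalHom φ.hom] :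
    (Spec.map φ ≫ X.fromSpecStalk x) (closedPoint R) = x := by
  change X.fromSpecStalk x (Spec.map φ (closedPoint R)) = x
  rw [Spec_closedPoint, Scheme.fromSpecStalk_closedPoint]

lemma Spec_hom_ext_of_injective {B R K : CommRingCat.{u}} {ι : R ⟶ K}
    (hι : Function.Injective ι) {a b : Spec R ⟶ Spec B} (h : Spec.map ι ≫ a = Spec.map ι ≫ b) :
    a = b := by
  obtain ⟨a, rfl⟩ := Spec.map_surjective a
  obtain ⟨b, rfl⟩ := Spec.map_surjective b
  rw [← Spec.map_comp, ← Spec.map_comp] at h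
  congr 1
  ext x
  exact hι congr($(Spec.map_injective h) x)

/-- Morphisms from the spectrum of a local domain are determined by the image of the closed point
and the restriction to the generic point. -/
lemma Spec_hom_ext_of_closedPoint {X : Scheme.{u}} {R K : CommRingCat.{u}} [IsLocalRing R]
    {ι : R ⟶ K} (hι : Function.Injective ι) {a b : Spec R ⟶ X}
    (hab : a (closedPoint R) = b (closedPoint R)) (h : Spec.map ι ≫ a = Spec.map ι ≫ b) :
    a = b := by
  obtain ⟨x, hx⟩ : ∃ x, b (closedPoint R) = x := ⟨_, rfl⟩
  obtain ⟨φ, -, rfl⟩ := exists_eq_SpecMap_comp_fromSpecStalk a (hab.trans hx)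
  obtain ⟨ψ, -, rfl⟩ := exists_eq_SpecMap_comp_fromSpecStalk b hx
  congr 1
  rw [← Spec.map_comp_assoc, ← Spec.map_comp_assoc] at h
  have := SpecMap_comp_fromSpecStalk_injective h
  congr 1
  ext x
  exact hι congr($this x)

end LocalRings

/-! ### Lifts of a `K`-point to valuation rings. -/

section Lifts

variable {K : Type u} [Field K] {X : Scheme.{u}}

/-- The morphisms from the spectrum of a valuation ring of `K` that extend a given `K`-point. -/
def valuativeLifts (η : Spec (.of K) ⟶ X) (O : ValuationSubring K) : Set (Spec (.of O) ⟶ X) :=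
  {g | Spec.map (CommRingCat.ofHom (algebraMap O K)) ≫ g = η}

variable {X' : Scheme.{u}}

lemma comp_mem_valuativeLifts {η : Spec (.of K) ⟶ X'} {O : ValuationSubring K} (h : X' ⟶ X)
    {g : Spec (.of O) ⟶ X'} (hg : g ∈ valuativeLifts η O) : g ≫ h ∈ valuativeLifts (η ≫ h) O := by
  change _ ≫ _ = _ at hg
  simp [valuativeLifts, reassoc_of% hg]

/-- A morphism satisfying the valuative criterion induces a bijection on lifts. -/
lemma bijOn_valuativeLifts (η : Spec (.of K) ⟶ X') (O : ValuationSubring K) {h : X' ⟶ X}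
    (hh : ValuativeCriterion h) :
    Set.BijOn (· ≫ h) (valuativeLifts η O) (valuativeLifts (η ≫ h) O) := by
  refine ⟨fun g ↦ comp_mem_valuativeLifts h, fun a ha b hb hab ↦ ?_, fun g hg ↦ ?_⟩
  · let S : ValuativeCommSq h := ⟨O, K, η, a ≫ h, ⟨(comp_mem_valuativeLifts h ha).symm⟩⟩
    have := hh.uniqueness S
    exact congr_arg CommSq.LiftStruct.l (Subsingleton.elim (α := S.commSq.LiftStruct)
      ⟨a, ha, rfl⟩ ⟨b, hb, hab.symm⟩)
  · let S : ValuativeCommSq h := ⟨O, K, η, g, ⟨Eq.symm hg⟩⟩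
    obtain ⟨⟨l⟩⟩ := hh.existence S
    exact ⟨l.l, l.fac_left, l.fac_right⟩

lemma valuativeLifts_comp_nonempty_iff (η : Spec (.of K) ⟶ X') (O : ValuationSubring K)
    {h : X' ⟶ X} (hh : ValuativeCriterion h) :
    (valuativeLifts (η ≫ h) O).Nonempty ↔ (valuativeLifts η O).Nonempty := by
  rw [← (bijOn_valuativeLifts η O hh).image_eq, Set.image_nonempty]

lemma algebraMap_mem_of_mem_valuativeLifts {k : Type u} [Field k] [Algebra k K]
    {η : Spec (.of K) ⟶ X} (s : X ⟶ Spec (.of k))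
    (hη : η ≫ s = Spec.map (CommRingCat.ofHom (algebraMap k K)))
    {O : ValuationSubring K} {g : Spec (.of O) ⟶ X} (hg : g ∈ valuativeLifts η O) (a : k) :
    algebraMap k K a ∈ O := by
  obtain ⟨b, hb⟩ := Spec.map_surjective (g ≫ s)
  have : b ≫ CommRingCat.ofHom (algebraMap O K) = CommRingCat.ofHom (algebraMap k K) := by
    apply Spec.map_injective
    rw [Spec.map_comp, hb, ← hη, ← Category.assoc]
    exact congr_arg (· ≫ s) hg
  have h : (b a : K) = algebraMap k K a := congr($this a)
  exact h ▸ (b a).2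

/-- Every valuation ring `O` of `K` has at most one center on the pointed scheme `η`, and it has one
if and only if `O` contains a fixed `k`-subalgebra of finite type. -/
def HasAffineValuations (k : Type u) [Field k] [Algebra k K] (η : Spec (.of K) ⟶ X) : Prop :=
  (∀ O, (valuativeLifts η O).Subsingleton) ∧
    ∃ A : Subalgebra k K, A.FG ∧ ∀ O, (valuativeLifts η O).Nonempty ↔ (A : Set K) ⊆ O

/-- The lifts to `X'` and to `X` correspond bijectively for each `O`, so the same algebra `A` serves
for both. For proper `h` this is the invariance behind part 2. -/
lemma hasAffineValuations_comp_iff (k : Type u) [Field k] [Algebra k K] (η : Spec (.of K) ⟶ X')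
    {h : X' ⟶ X} (hh : ValuativeCriterion h) :
    HasAffineValuations k (η ≫ h) ↔ HasAffineValuations k η := by
  have h₁ (O) : (valuativeLifts (η ≫ h) O).Subsingleton ↔ (valuativeLifts η O).Subsingleton := by
    rw [← (bijOn_valuativeLifts η O hh).image_eq]
    exact ⟨fun H a ha b hb ↦ (bijOn_valuativeLifts η O hh).injOn ha hb
      (H (Set.mem_image_of_mem _ ha) (Set.mem_image_of_mem _ hb)), fun H ↦ H.image _⟩
  simp only [HasAffineValuations, h₁, valuativeLifts_comp_nonempty_iff η _ hh]

end Lifts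

/-! ### The valuative criterion, tested at the generic point. -/

section DominantValuativeCriterion

variable {K : Type u} [Field K] {X : Scheme.{u}}

/-- The valuative criterion for a morphism to an affine scheme can be checked on extensions of a
fixed generic point. -/
theorem ValuativeCriterion.of_generic {B : CommRingCat.{u}} (f : X ⟶ Spec B)
    (η : Spec (.of K) ⟶ X) (hη : ∀ x, η (closedPoint K) ⤳ x)
    (H : ∀ O : ValuationSubring K, (valuativeLifts (η ≫ f) O).Nonempty →
      ∃ g, valuativeLifts η O = {g}) : ValuativeCriterion f := by
  intro S
  obtain ⟨R, K', i₁, i₂, ⟨w⟩⟩ := S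
  set x : X := i₁ (closedPoint K') with hx
  obtain ⟨φ, hφ, hφi⟩ := exists_eq_SpecMap_comp_fromSpecStalk i₁ hx.symm
  let ψ : X.presheaf.stalk x ⟶ .of K :=
    X.presheaf.stalkSpecializes (hη x) ≫ Scheme.stalkClosedPointTo η
  have hψη : Spec.map ψ ≫ X.fromSpecStalk x = η := by
    rw [Spec.map_comp, Category.assoc, Scheme.SpecMap_stalkSpecializes_fromSpecStalk]
    exact Scheme.Spec_stalkClosedPointTo_fromSpecStalk η
  let W : ValuationSubring K' :=
    ⟨(algebraMap R K').range, ValuationRing.isInteger_or_isInteger R⟩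
  -- `V` dominates the local ring at `x`, and `V'` is its composite with an extension of the trace
  -- of `R` on the residue field of `x`. Membership in `V'` and in `R` thus agree on the stalk at
  -- `x`, which transports the problem from `K'` to `K`.
  obtain ⟨V, V', hV'V, ⟨hψV, hψVloc⟩, hVW⟩ :=
    ValuationSubring.exists_forall_mem_iff (K := K) (K' := K') ψ.hom φ.hom W
  obtain ⟨b, hb⟩ := Spec.map_surjective i₂
  obtain ⟨β, hβ⟩ := Spec.map_surjective (X.fromSpecStalk x ≫ f)
  have hβφ : β ≫ φ = b ≫ CommRingCat.ofHom (algebraMap R K') := by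
    apply Spec.map_injective
    rw [Spec.map_comp, Spec.map_comp, hβ, hb, reassoc_of% hφi, w]
  have hβV (c : B) : ψ (β c) ∈ V' := (hVW _).mpr ⟨b c, congr($hβφ c).symm⟩
  let βV : B ⟶ .of V' := CommRingCat.ofHom ((β ≫ ψ).hom.codRestrict V'.toSubring hβV)
  have hlift : Spec.map βV ∈ valuativeLifts (η ≫ f) V' := by
    change _ ≫ _ = _
    rw [← hψη, Category.assoc, ← hβ, ← Spec.map_comp, ← Spec.map_comp]
    rfl
  obtain ⟨g, hg⟩ := H V' ⟨_, hlift⟩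
  have halg : Function.Injective (algebraMap R K') := IsFractionRing.injective R K'
  -- A lift over `R` induces a lift of `η` over `V'` with the same center, so its center is that of
  -- the unique lift `g`. Center and generic point together determine `l`.
  have hunique (l : Spec (.of R) ⟶ X)
      (hl : Spec.map (CommRingCat.ofHom (algebraMap R K')) ≫ l = i₁) :
      l (closedPoint R) = g (closedPoint V') := by
    obtain ⟨c, hc⟩ : ∃ c, l (closedPoint R) = c := ⟨_, rfl⟩
    obtain ⟨θ, hθ, hθl⟩ := exists_eq_SpecMap_comp_fromSpecStalk l hc
    have hxc : x ⤳ c := by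
      have : x = l (Spec.map (CommRingCat.ofHom (algebraMap R K')) (closedPoint K')) := by
        rw [hx, ← hl]
        rfl
      rw [this, ← hc]
      exact (specializes_closedPoint (R := R) _).map l.continuous
    let sp := X.presheaf.stalkSpecializes hxc
    have hsp : θ ≫ CommRingCat.ofHom (algebraMap R K') = sp ≫ φ := by
      apply SpecMap_comp_fromSpecStalk_injective
      rw [Spec.map_comp, Spec.map_comp, Category.assoc, Category.assoc, hθl, hl,
        Scheme.SpecMap_stalkSpecializes_fromSpecStalk, hφi]
    have hmem (a) : ψ (sp a) ∈ V' := (hVW _).mpr ⟨θ a, congr($hsp a)⟩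
    let χ : X.presheaf.stalk c ⟶ .of V' :=
      CommRingCat.ofHom ((sp ≫ ψ).hom.codRestrict V'.toSubring hmem)
    -- If `a` becomes a unit in `V'`, it is a unit in `V`, hence in the stalk at `x` by domination.
    -- The inverse there lies in `V'` under `ψ`, hence in `R` under `φ`, so `θ a` is a unit and so
    -- is `a`.
    have : IsLocalHom χ.hom := by
      refine ⟨fun a ha ↦ hθ.1 _ ?_⟩
      obtain ⟨⟨d, hd⟩, had⟩ := isUnit_iff_exists_inv.mp ha
      replace had : ψ (sp a) * d = 1 := congr(($had).1)
      have : IsUnit (sp a) := hψVloc.1 _ (IsUnit.of_mul_eq_one ⟨d, hV'V hd⟩ (Subtype.ext had))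
      obtain ⟨u, hu⟩ := isUnit_iff_exists_inv.mp this
      have hud : ψ u = d := by
        have h1 : ψ (sp a) * ψ u = 1 := by rw [← map_mul, hu, map_one]
        exact mul_left_cancel₀ (left_ne_zero_of_mul_eq_one h1) (h1.trans had.symm)
      obtain ⟨r, hr⟩ := (hVW u).mp (by rw [← hud] at hd; exact hd)
      refine IsUnit.of_mul_eq_one r (halg ?_)
      have h2 : algebraMap R K' (θ a) = φ (sp a) := congr($hsp a)
      rw [map_mul, map_one]
      refine (congr_arg₂ (· * ·) h2 hr).trans ?_
      change φ (sp a) * φ u = 1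
      rw [← map_mul, hu, map_one]
    have hχ : Spec.map χ ≫ X.fromSpecStalk c ∈ valuativeLifts η V' := by
      change _ ≫ _ = _
      rw [← Spec.map_comp_assoc]
      change Spec.map (sp ≫ ψ) ≫ _ = _
      rw [Spec.map_comp, Category.assoc, Scheme.SpecMap_stalkSpecializes_fromSpecStalk, hψη]
    rw [hg, Set.mem_singleton_iff] at hχ
    rw [← hχ, hc]
    exact (SpecMap_comp_fromSpecStalk_closedPoint (R := .of V') χ).symm
  refine (unique_iff_subsingleton_and_nonempty _).mpr ⟨⟨fun l l' ↦ ?_⟩, ?_⟩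
  · ext : 1
    refine Spec_hom_ext_of_closedPoint (R := .of R) (ι := CommRingCat.ofHom (algebraMap R K')) halg
      ?_ (l.fac_left.trans l'.fac_left.symm)
    exact (hunique _ l.fac_left).trans (hunique _ l'.fac_left).symm
  · obtain ⟨c, hc⟩ : ∃ c, g (closedPoint V') = c := ⟨_, rfl⟩
    obtain ⟨γ, -, hγg⟩ := exists_eq_SpecMap_comp_fromSpecStalk g hc
    have hgmem : g ∈ valuativeLifts η V' := hg ▸ rfl
    -- Restricting `g` along `V' ⊆ V` gives a lift over `V`. By uniqueness over `V` it is the one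
    -- centered at `x`, so `x` lies in the image of `g` and specializes to its center.
    have hxc : x ⤳ c := by
      let ι : CommRingCat.of V' ⟶ .of V := CommRingCat.ofHom (ValuationSubring.inclusion V' V hV'V)
      let ψV : X.presheaf.stalk x ⟶ .of V := CommRingCat.ofHom (ψ.hom.codRestrict V.toSubring hψV)
      have : IsLocalHom ψV.hom := hψVloc
      have h1 : Spec.map ι ≫ g ∈ valuativeLifts η V := by
        change _ ≫ _ = _
        rw [← Spec.map_comp_assoc]
        exact hgmem
      have h2 : Spec.map ψV ≫ X.fromSpecStalk x ∈ valuativeLifts η V := by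
        change _ ≫ _ = _
        rw [← Spec.map_comp_assoc]
        exact hψη
      obtain ⟨g', hg'⟩ := H V ⟨_, comp_mem_valuativeLifts f h1⟩
      rw [hg', Set.mem_singleton_iff] at h1 h2
      have h3 : x = g (Spec.map ι (closedPoint V)) := by
        rw [← SpecMap_comp_fromSpecStalk_closedPoint (R := .of V) ψV, h2, ← h1]
        rfl
      rw [h3, ← hc]
      exact (specializes_closedPoint (R := V') _).map g.continuous
    let sp := X.presheaf.stalkSpecializes hxc
    have hsp : γ ≫ CommRingCat.ofHom (algebraMap V' K) = sp ≫ ψ := by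
      apply SpecMap_comp_fromSpecStalk_injective
      rw [Spec.map_comp, Spec.map_comp, Category.assoc, Category.assoc, hγg,
        Scheme.SpecMap_stalkSpecializes_fromSpecStalk, hψη]
      exact hgmem
    have hmem (a) : φ (sp a) ∈ (algebraMap R K').range := by
      refine (hVW _).mp ?_
      have : algebraMap V' K (γ a) = ψ (sp a) := congr($hsp a)
      exact this ▸ (γ a).2
    let e : R ≃+* (algebraMap R K').range := RingEquiv.ofBijective _
      ⟨fun a b h ↦ halg (congr_arg Subtype.val h), (algebraMap R K').rangeRestrict_surjective⟩
    let θ : X.presheaf.stalk c ⟶ .of R :=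
      CommRingCat.ofHom (e.symm.toRingHom.comp ((sp ≫ φ).hom.codRestrict _ hmem))
    have hθ : θ ≫ CommRingCat.ofHom (algebraMap R K') = sp ≫ φ := by
      ext a
      exact congr_arg Subtype.val (e.apply_symm_apply ⟨φ (sp a), hmem a⟩)
    have hl : Spec.map (CommRingCat.ofHom (algebraMap R K')) ≫ Spec.map θ ≫ X.fromSpecStalk c =
        i₁ := by
      rw [← Spec.map_comp_assoc, hθ, Spec.map_comp, Category.assoc,
        Scheme.SpecMap_stalkSpecializes_fromSpecStalk, hφi]
    refine ⟨⟨Spec.map θ ≫ X.fromSpecStalk c, hl, ?_⟩⟩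
    refine Spec_hom_ext_of_injective (ι := CommRingCat.ofHom (algebraMap R K')) halg ?_
    rw [← w, Category.assoc, ← Category.assoc, ← Category.assoc, Category.assoc (Spec.map _), hl]

end DominantValuativeCriterion
end AlgebraicGeometry

/-! ### Points of the attached space as lifts. -/

lemma LocalSubring.range_le_iff {R K : Type*} [CommRing R] [IsLocalRing R] [Field K] (f : R →+* K)
    (B : LocalSubring K) : LocalSubring.range f ≤ B ↔
      ∃ h : ∀ a, f a ∈ B.toSubring, IsLocalHom (f.codRestrict B.toSubring h) := by
  constructor
  · rintro ⟨h, h'⟩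
    exact ⟨fun x ↦ h ⟨x, rfl⟩,
      @RingHom.isLocalHom_comp _ _ _ _ _ _ _ _ h' (.of_surjective _ f.rangeRestrict_surjective)⟩
  · rintro ⟨h, h'⟩
    have hle : (LocalSubring.range f).toSubring ≤ B.toSubring := by
      rintro _ ⟨x, rfl⟩
      exact h x
    refine ⟨hle, ⟨?_⟩⟩
    rintro ⟨_, x, rfl⟩ hx
    exact (h'.1 x hx).map f.rangeRestrict

namespace PointedIntegralScheme

open IsLocalRing

variable {k K : Type u} [Field k] [Field K] [Algebra k K] (M : PointedIntegralScheme k K)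

lemma SpecMap_stalkToField_comp_fromSpecStalk (x : M.X) :
    Spec.map (CommRingCat.ofHom (M.stalkToField x)) ≫ M.X.fromSpecStalk x = M.η := by
  refine (congr_arg (· ≫ M.X.fromSpecStalk x) (Spec.map_comp _ _)).trans ?_
  rw [Category.assoc, Scheme.SpecMap_stalkSpecializes_fromSpecStalk]
  exact Scheme.Spec_stalkClosedPointTo_fromSpecStalk M.η

/-- Domination says that the map from the stalk to `K` factors through a local homomorphism to `O`,
and such homomorphisms are the morphisms from `Spec O` sending the closed point to `x`. -/
lemma localSubring_le_iff (x : M.X) (O : ValuationSubring K) :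
    M.localSubring x ≤ O.toLocalSubring ↔ ∃ g ∈ valuativeLifts M.η O, g (closedPoint O) = x := by
  rw [localSubring, LocalSubring.range_le_iff]
  constructor
  · rintro ⟨h, h'⟩
    let φ : M.X.presheaf.stalk x ⟶ .of O := CommRingCat.ofHom ((M.stalkToField x).codRestrict _ h)
    have : IsLocalHom φ.hom := h'
    refine ⟨Spec.map φ ≫ M.X.fromSpecStalk x, ?_, SpecMap_comp_fromSpecStalk_closedPoint φ⟩
    change _ ≫ _ = _
    rw [← Spec.map_comp_assoc]
    exact M.SpecMap_stalkToField_comp_fromSpecStalk x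
  · rintro ⟨g, hg, hgx⟩
    obtain ⟨φ, hφ, rfl⟩ := exists_eq_SpecMap_comp_fromSpecStalk g hgx
    have hφx : φ ≫ CommRingCat.ofHom (algebraMap O K) = CommRingCat.ofHom (M.stalkToField x) := by
      apply SpecMap_comp_fromSpecStalk_injective
      rw [M.SpecMap_stalkToField_comp_fromSpecStalk, Spec.map_comp, Category.assoc]
      exact hg
    have hφx' (a) : (φ a : K) = M.stalkToField x a := congr($hφx a)
    have h (a) : M.stalkToField x a ∈ O.toLocalSubring.toSubring := by
      rw [← hφx']
      exact (φ a).2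
    refine ⟨h, ⟨fun a ha ↦ hφ.1 a ?_⟩⟩
    rw [show φ.hom a = (⟨M.stalkToField x a, h a⟩ : O) from Subtype.ext (hφx' a)]
    exact ha

lemma mem_range_toRZ_iff (p : RiemannZariski k K) :
    p ∈ Set.range M.toRZ ↔ (valuativeLifts M.η p.ring).Nonempty := by
  constructor
  · rintro ⟨⟨⟨p, x⟩, hx⟩, rfl⟩
    obtain ⟨g, hg, -⟩ := (M.localSubring_le_iff _ _).mp hx
    exact ⟨g, hg⟩
  · rintro ⟨g, hg⟩
    exact ⟨⟨⟨p, g (closedPoint p.ring)⟩, (M.localSubring_le_iff _ p.ring).mpr ⟨g, hg, rfl⟩⟩, rfl⟩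

/-- A point of the space records only the center of a lift, but the center and the restriction to
`Spec K` determine the lift. -/
lemma injective_toRZ_iff :
    Function.Injective M.toRZ ↔ ∀ O, (valuativeLifts M.η O).Subsingleton := by
  constructor
  · intro H O a ha b hb
    let p : RiemannZariski k K := ⟨O, algebraMap_mem_of_mem_valuativeLifts M.str M.η_str ha⟩
    let pa : M.Space := ⟨⟨p, a (closedPoint O)⟩, (M.localSubring_le_iff _ O).mpr ⟨a, ha, rfl⟩⟩
    let pb : M.Space := ⟨⟨p, b (closedPoint O)⟩, (M.localSubring_le_iff _ O).mpr ⟨b, hb, rfl⟩⟩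
    have hab : pa = pb := H rfl
    exact Spec_hom_ext_of_closedPoint (R := .of O) (ι := CommRingCat.ofHom (algebraMap O K))
      Subtype.val_injective congr(($hab).1.2) (ha.trans hb.symm)
  · rintro H ⟨⟨p, x⟩, hx⟩ ⟨⟨q, y⟩, hy⟩ (rfl : p = q)
    obtain ⟨a, ha, hax⟩ := (M.localSubring_le_iff x p.ring).mp hx
    obtain ⟨b, hb, hby⟩ := (M.localSubring_le_iff y p.ring).mp hy
    obtain rfl := H _ ha hb
    obtain rfl := hax.symm.trans hby
    rfl

lemma hasAffineValuations_iff : HasAffineValuations k M.η ↔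
    Function.Injective M.toRZ ∧ RiemannZariski.IsAffineSubset (Set.range M.toRZ) := by
  rw [HasAffineValuations, M.injective_toRZ_iff]
  refine and_congr_right fun _ ↦ exists_congr fun A ↦ and_congr_right fun _ ↦ ?_
  rw [Set.ext_iff]
  simp only [M.mem_range_toRZ_iff]
  constructor
  · exact fun H p ↦ H p.ring
  · intro H O
    by_cases hO : ∀ a, algebraMap k K a ∈ O
    · exact H ⟨O, hO⟩
    · refine iff_of_false ?_ ?_
      · rintro ⟨g, hg⟩
        exact hO (algebraMap_mem_of_mem_valuativeLifts M.str M.η_str hg)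
      · exact fun h ↦ hO fun a ↦ h (A.algebraMap_mem a)

lemma IsModelOf.isAffine_iff {M : PointedIntegralScheme k K} {B : BirationalSpace.{u, v} k K}
    (h : M.IsModelOf B) : B.IsAffine ↔ HasAffineValuations k M.η := by
  obtain ⟨e, he⟩ := h
  have : M.toRZ = B.toRZ ∘ e := funext fun p ↦ (he p).symm
  rw [hasAffineValuations_iff, BirationalSpace.IsAffine, this, e.surjective.range_comp,
    show Function.Injective (B.toRZ ∘ e) ↔ _ from e.toEquiv.injective_comp _]

end PointedIntegralScheme

/-! ### The normalization: finiteness and global sections. -/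

namespace AlgebraicGeometry.Scheme

lemma exists_finiteType_sections {X : Scheme.{u}} {k : Type u} [Field k] (s : X ⟶ Spec (.of k))
    [LocallyOfFiniteType s] {U : X.Opens} (hU : IsAffineOpen U) :
    ∃ f : k →+* Γ(X, U), f.FiniteType := by
  have := s.finiteType_appLE (isAffineOpen_top _) hU le_top
  exact ⟨_, this.comp (.of_surjective (ΓSpecIso (.of k)).inv.hom
    (ConcreteCategory.bijective_of_isIso (ΓSpecIso (.of k)).inv).2)⟩

variable (X : Scheme.{u}) [IsIntegral X]

instance : IsIntegralHom X.integralNormalizationMap :=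
  inferInstanceAs (IsIntegralHom (X.fromSpecStalk (genericPoint X)).fromNormalization)

instance : IsIntegral X.integralNormalization :=
  have : IsIntegral (Spec (X.presheaf.stalk (genericPoint X))) :=
    inferInstanceAs (IsIntegral (Spec X.functionField))
  inferInstanceAs (IsIntegral (X.fromSpecStalk (genericPoint X)).normalization)

/-- The canonical map from the function field to the sections of its spectrum. -/
noncomputable def functionFieldToSections (V : (Spec X.functionField).Opens) :
    X.functionField ⟶ Γ(Spec X.functionField, V) :=
  (ΓSpecIso X.functionField).inv ≫ (Spec X.functionField).presheaf.map (homOfLE le_top).op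

lemma functionFieldToSections_map {V W : (Spec X.functionField).Opens} (h : W ≤ V) :
    X.functionFieldToSections V ≫ (Spec X.functionField).presheaf.map (homOfLE h).op =
      X.functionFieldToSections W := by
  simp only [functionFieldToSections, Category.assoc, ← Functor.map_comp]
  rfl

lemma germToFunctionField_functionFieldToSections (U : X.Opens) [Nonempty U] :
    X.germToFunctionField U ≫ X.functionFieldToSections _ =
      (X.fromSpecStalk (genericPoint X)).app U :=
  (fromSpecStalk_app _).symm

lemma fromSpecStalk_genericPoint_preimage (U : X.Opens) [h : Nonempty U] :
    X.fromSpecStalk (genericPoint X) ⁻¹ᵁ U = ⊤ :=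
  preimage_eq_top_of_closedPoint_mem _ (by
    rw [fromSpecStalk_closedPoint]
    exact ((genericPoint_spec X).mem_open_set_iff U.isOpen).mpr (by simpa using h))

lemma functionFieldToSections_bijective (U : X.Opens) [Nonempty U] :
    Function.Bijective
      (X.functionFieldToSections (X.fromSpecStalk (genericPoint X) ⁻¹ᵁ U)) := by
  rw [X.fromSpecStalk_genericPoint_preimage U]
  rw [← ConcreteCategory.isIso_iff_bijective]
  have : (Spec X.functionField).presheaf.map (homOfLE (le_top (a := ⊤))).op = 𝟙 _ :=
    (Spec X.functionField).presheaf.map_id _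
  rw [functionFieldToSections, this, Category.comp_id]
  infer_instance

/-- The normalization of an integral scheme of finite type over a field is finite. -/
theorem isFinite_integralNormalizationMap {k : Type u} [Field k] (s : X ⟶ Spec (.of k))
    [LocallyOfFiniteType s] : IsFinite X.integralNormalizationMap := by
  rw [isFinite_iff]
  refine ⟨inferInstance, fun U hU ↦ ?_⟩
  let f := X.fromSpecStalk (genericPoint X)
  have e : X.integralNormalizationMap.app U = _ := f.fromNormalization_app hU
  rw [e]
  let := (f.app U).hom.toAlgebra
  suffices Module.Finite Γ(X, U) (integralClosure Γ(X, U) Γ(Spec X.functionField, f ⁻¹ᵁ U)) by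
    refine RingHom.Finite.comp (.of_surjective _
      (ConcreteCategory.bijective_of_isIso (f.normalizationObjIso hU).inv).2) ?_
    exact RingHom.finite_algebraMap.mpr this
  -- The germ map to the function field requires a nonempty open; over the empty one all sections
  -- vanish.
  rcases isEmpty_or_nonempty U with h | h
  · obtain rfl : U = ⊥ := by ext x; simpa using fun hx ↦ h.elim ⟨x, hx⟩
    have : Subsingleton Γ(Spec X.functionField, f ⁻¹ᵁ ⊥) :=
      inferInstanceAs (Subsingleton Γ(Spec X.functionField, ⊥))
    infer_instance
  have := functionField_isFractionRing_of_isAffineOpen X U hU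
  obtain ⟨φ, hφ⟩ := exists_finiteType_sections s hU
  let := φ.toAlgebra
  have : Algebra.FiniteType k Γ(X, U) := hφ
  have := Algebra.FiniteType.finite_integralClosure k Γ(X, U) X.functionField
  let j : X.functionField ≃ₐ[Γ(X, U)] Γ(Spec X.functionField, f ⁻¹ᵁ U) :=
    AlgEquiv.ofBijective
      { (X.functionFieldToSections (f ⁻¹ᵁ U)).hom with
        commutes' := fun a ↦ congr($(X.germToFunctionField_functionFieldToSections U) a) }
      (X.functionFieldToSections_bijective U)
  exact Module.Finite.equiv j.mapIntegralClosure.toLinearEquiv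

/-- The generic point of the normalization. -/
noncomputable def toIntegralNormalization : Spec X.functionField ⟶ X.integralNormalization :=
  (X.fromSpecStalk (genericPoint X)).toNormalization

instance : IsDominant X.toIntegralNormalization :=
  inferInstanceAs (IsDominant (X.fromSpecStalk (genericPoint X)).toNormalization)

instance : QuasiCompact X.toIntegralNormalization :=
  inferInstanceAs (QuasiCompact (X.fromSpecStalk (genericPoint X)).toNormalization)

instance : IsSchemeTheoreticallyDominant X.toIntegralNormalization :=
  .of_isDominant _

lemma toIntegralNormalization_integralNormalizationMap :
    X.toIntegralNormalization ≫ X.integralNormalizationMap = X.fromSpecStalk (genericPoint X) :=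
  Hom.toNormalization_fromNormalization _

variable {X}

/-- An element of the function field that is integral over the sections on an affine open `U` is
a section of the normalization over `U`. -/
lemma exists_app_eq_of_isIntegral {U : X.Opens} (hU : IsAffineOpen U) [Nonempty U]
    {l : X.functionField} (hl : _root_.IsIntegral Γ(X, U) l) :
    ∃ s : Γ(X.integralNormalization, X.integralNormalizationMap ⁻¹ᵁ U),
      X.toIntegralNormalization.app _ s = X.functionFieldToSections _ l := by
  let f := X.fromSpecStalk (genericPoint X)
  let := (f.app U).hom.toAlgebra
  let j : X.functionField →ₐ[Γ(X, U)] Γ(Spec X.functionField, f ⁻¹ᵁ U) :=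
    { (X.functionFieldToSections (f ⁻¹ᵁ U)).hom with
      commutes' := fun a ↦ congr($(X.germToFunctionField_functionFieldToSections U) a) }
  let c : integralClosure Γ(X, U) Γ(Spec X.functionField, f ⁻¹ᵁ U) := ⟨j l, hl.map j⟩
  have hpre : X.toIntegralNormalization ⁻¹ᵁ X.integralNormalizationMap ⁻¹ᵁ U = f ⁻¹ᵁ U := by
    rw [← Hom.comp_preimage, toIntegralNormalization_integralNormalizationMap]
  let s : Γ(X.integralNormalization, X.integralNormalizationMap ⁻¹ᵁ U) :=
    (f.normalizationObjIso hU).inv c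
  refine ⟨s, ?_⟩
  have h1 : X.toIntegralNormalization.appLE (X.integralNormalizationMap ⁻¹ᵁ U) (f ⁻¹ᵁ U)
      hpre.ge s = X.functionFieldToSections _ l := by
    have h2 := congr($(f.normalizationObjIso_hom_val hU) s)
    refine h2.symm.trans ?_
    have h3 : (f.normalizationObjIso hU).hom s = c :=
      congr($((f.normalizationObjIso hU).inv_hom_id) c)
    exact congr_arg Subtype.val h3
  have h4 := congr_arg ((Spec X.functionField).presheaf.map (homOfLE hpre.le).op) h1
  rw [← ConcreteCategory.comp_apply, ← ConcreteCategory.comp_apply,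
    functionFieldToSections_map, Hom.appLE_map] at h4
  rw [← h4, Hom.app_eq_appLE]

/-- An element of the function field that is integral over the sections on all affine opens is a
global section of the normalization. -/
lemma exists_appTop_eq_of_isIntegral (l : X.functionField)
    (hl : ∀ (U : X.Opens) [Nonempty U], IsAffineOpen U → _root_.IsIntegral Γ(X, U) l) :
    ∃ s : Γ(X.integralNormalization, ⊤),
      X.toIntegralNormalization.appTop s = (ΓSpecIso X.functionField).inv l := by
  have hcover (x : X) : ∃ U : X.Opens, IsAffineOpen U ∧ x ∈ U := by
    obtain ⟨_, ⟨U, hU, rfl⟩, hxU, -⟩ :=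
      X.isBasis_affineOpens.exists_subset_of_mem_open (Set.mem_univ x) isOpen_univ
    exact ⟨U, hU, hxU⟩
  choose U hU hxU using hcover
  have (x : X) : Nonempty (U x) := ⟨⟨x, hxU x⟩⟩
  choose s hs using fun x ↦ exists_app_eq_of_isIntegral (hU x) (hl (U x) (hU x))
  obtain ⟨(σ : Γ(X.integralNormalization, ⊤)), hσ, -⟩ :=
    X.integralNormalization.sheaf.existsUnique_gluing'
    (fun x ↦ X.integralNormalizationMap ⁻¹ᵁ U x) ⊤ (fun x ↦ homOfLE le_top)
    (fun y _ ↦ TopologicalSpace.Opens.mem_iSup.mpr ⟨X.integralNormalizationMap y, hxU _⟩) s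
    -- Sections of the normalization inject into those of its generic point, where all local choices
    -- restrict to `l`; hence they agree on overlaps.
    (fun x y ↦ X.toIntegralNormalization.app_injective _ (by
      have key {V W : X.integralNormalization.Opens} (h : W ≤ V)
          (s : Γ(X.integralNormalization, V))
          (hs : X.toIntegralNormalization.app _ s = X.functionFieldToSections _ l) :
          X.toIntegralNormalization.app W (X.integralNormalization.presheaf.map (homOfLE h).op s) =
            X.functionFieldToSections _ l := by
        rw [← ConcreteCategory.comp_apply, Hom.naturality, ConcreteCategory.comp_apply, hs,
          ← ConcreteCategory.comp_apply]
        exact congr($(X.functionFieldToSections_map (Hom.preimage_mono _ h)) l)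
      exact (key inf_le_left _ (hs x)).trans (key inf_le_right _ (hs y)).symm))
  refine ⟨σ, ?_⟩
  let x := genericPoint X
  have h1 : X.toIntegralNormalization.app _
      (X.integralNormalization.presheaf.map (homOfLE le_top).op σ) =
      X.functionFieldToSections _ l := (congr_arg _ (hσ x)).trans (hs x)
  -- One member of the cover suffices to compute the value of `σ`, since its preimage in the
  -- spectrum of the function field is everything.
  have hpre : ⊤ ≤ X.toIntegralNormalization ⁻¹ᵁ X.integralNormalizationMap ⁻¹ᵁ (U x) := by
    rw [← Hom.comp_preimage, toIntegralNormalization_integralNormalizationMap,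
      fromSpecStalk_genericPoint_preimage]
  have h2 := congr_arg ((Spec X.functionField).presheaf.map (homOfLE hpre).op) h1
  rw [← ConcreteCategory.comp_apply, ← ConcreteCategory.comp_apply, ← ConcreteCategory.comp_apply,
    functionFieldToSections_map, Hom.naturality_assoc, ← Functor.map_comp] at h2
  have h3 : X.functionFieldToSections ⊤ = (ΓSpecIso X.functionField).inv :=
    (congr_arg _ ((Spec X.functionField).presheaf.map_id _)).trans (Category.comp_id _)
  rw [← h3, ← h2]
  exact congr($((congr_arg (X.toIntegralNormalization.appTop ≫ ·)
    ((Spec X.functionField).presheaf.map_id _)).trans (Category.comp_id _)) σ).symm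

end AlgebraicGeometry.Scheme

/-! ### Integrality, minimal polynomials and valuation rings. -/

/-- If `a` is integral over `C`, so are the coefficients of its minimal polynomial over a field
containing the image of `C`. -/
lemma IsIntegral.coeff_minpoly {C L K : Type*} [CommRing C] [Field L] [Field K] [Algebra C L]
    [Algebra L K] [Algebra C K] [IsScalarTower C L K] {a : K} (ha : IsIntegral C a) (i : ℕ) :
    IsIntegral C ((minpoly L a).coeff i) := by
  obtain ⟨f, hf, hfa⟩ := ha
  have hdvd : minpoly L a ∣ f.map (algebraMap C L) := minpoly.dvd _ _ (by
    rwa [Polynomial.aeval_map_algebraMap, Polynomial.aeval_def])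
  have hint : IsIntegral L a := ⟨f.map (algebraMap C L), hf.map _, by
    rwa [Polynomial.eval₂_map, ← IsScalarTower.algebraMap_eq]⟩
  have := integralClosure.mem_lifts_of_monic_of_dvd_map L hf (minpoly.monic hint) hdvd
  obtain ⟨y, hy⟩ := (Polynomial.lifts_iff_coeff_lifts _).mp this i
  rw [← hy]
  exact y.2

/-- An element is contained in a valuation ring if the coefficients of its minimal polynomial
are. -/
lemma ValuationSubring.mem_of_coeff_minpoly_mem {L K : Type*} [Field L] [Field K] [Algebra L K]
    {a : K} (ha : IsIntegral L a) (O : ValuationSubring K)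
    (h : ∀ i, algebraMap L K ((minpoly L a).coeff i) ∈ O) : a ∈ O := by
  have hlift : (minpoly L a).map (algebraMap L K) ∈ Polynomial.lifts (algebraMap O K) := by
    rw [Polynomial.lifts_iff_coeff_lifts]
    intro i
    rw [Polynomial.coeff_map]
    exact ⟨⟨_, h i⟩, rfl⟩
  obtain ⟨q, hq, -, hqm⟩ := Polynomial.lifts_and_degree_eq_and_monic hlift
    ((minpoly.monic ha).map _)
  have hO : IsIntegral O a := ⟨q, hqm, by
    rw [← Polynomial.eval_map, hq, Polynomial.eval_map, ← Polynomial.aeval_def, minpoly.aeval]⟩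
  obtain ⟨y, rfl⟩ := IsIntegrallyClosed.isIntegral_iff.mp hO
  exact y.2

/-- An element contained in all valuation rings over the image of `C` is integral over `C`. -/
lemma isIntegral_of_forall_mem_valuationSubring {C K : Type*} [CommRing C] [Field K] [Algebra C K]
    {a : K} (h : ∀ V : ValuationSubring K, (∀ c, algebraMap C K c ∈ V) → a ∈ V) :
    IsIntegral C a := by
  -- The integral closure of a subring of a field is the intersection of the valuation rings
  -- containing it. Integrality over the image of `C` is pulled back to `C` afterwards.
  have hmem : a ∈ (integralClosure (Subring.closure (Set.range (algebraMap C K))) K).toSubring := by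
    rw [← iInf_valuationSubring_superset, Subring.mem_iInf]
    exact fun V ↦ h V.1 fun c ↦ V.2 ⟨c, rfl⟩
  have hcl : Subring.closure (Set.range (algebraMap C K)) = (algebraMap C K).range :=
    Subring.closure_eq (algebraMap C K).range
  rw [hcl] at hmem
  let : Algebra C (algebraMap C K).range := (algebraMap C K).rangeRestrict.toAlgebra
  have : IsScalarTower C (algebraMap C K).range K := .of_algebraMap_eq fun _ ↦ rfl
  have : Algebra.IsIntegral C (algebraMap C K).range := ⟨by
    rintro ⟨_, c, rfl⟩
    exact isIntegral_algebraMap (R := C) (A := (algebraMap C K).range) (x := c)⟩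
  exact isIntegral_trans (R := C) (A := (algebraMap C K).range) a hmem

/-! ### Valuations attached to affine schemes. -/

namespace AlgebraicGeometry

open IsLocalRing

lemma IsProper.valuativeCriterion {X Y : Scheme.{u}} (f : X ⟶ Y) [h : IsProper f] :
    ValuativeCriterion f := by
  rw [IsProper.eq_valuativeCriterion] at h
  exact h.1.1.1

variable {k K : Type u} [Field k] [Field K] [Algebra k K]

lemma valuativeLifts_SpecMap_nonempty_iff {B : CommRingCat.{u}} (ρ : B ⟶ .of K)
    (O : ValuationSubring K) : (valuativeLifts (Spec.map ρ) O).Nonempty ↔ ∀ b, ρ b ∈ O := by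
  constructor
  · rintro ⟨g, hg⟩ b
    obtain ⟨β, rfl⟩ := Spec.map_surjective g
    have h : β ≫ CommRingCat.ofHom (algebraMap O K) = ρ := by
      apply Spec.map_injective
      rw [Spec.map_comp]
      exact hg
    have h' : (β b : K) = ρ b := congr($h b)
    exact h' ▸ (β b).2
  · intro h
    refine ⟨Spec.map (CommRingCat.ofHom (ρ.hom.codRestrict O.toSubring h)), ?_⟩
    change _ ≫ _ = _
    rw [← Spec.map_comp]
    rfl

/-- The space of valuations attached to an affine scheme of finite type is affine. -/
lemma hasAffineValuations_of_Spec {B : CommRingCat.{u}} (η : Spec (.of K) ⟶ Spec B)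
    (s : Spec B ⟶ Spec (.of k)) [LocallyOfFiniteType s]
    (hη : η ≫ s = Spec.map (CommRingCat.ofHom (algebraMap k K))) : HasAffineValuations k η := by
  refine ⟨fun O a ha b hb ↦ Spec_hom_ext_of_injective (ι := CommRingCat.ofHom (algebraMap O K))
    Subtype.val_injective (ha.trans hb.symm), ?_⟩
  obtain ⟨ρ, rfl⟩ := Spec.map_surjective η
  obtain ⟨κ, rfl⟩ := Spec.map_surjective s
  have hκ : κ.hom.FiniteType := (HasRingHomProperty.Spec_iff (P := @LocallyOfFiniteType)).mp ‹_›
  let : Algebra k B := κ.hom.toAlgebra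
  have : Algebra.FiniteType k B := hκ
  have hκρ : κ ≫ ρ = CommRingCat.ofHom (algebraMap k K) := by
    apply Spec.map_injective
    rw [Spec.map_comp, hη]
  let ρ' : B →ₐ[k] K := { ρ.hom with commutes' := fun c ↦ congr($hκρ c) }
  refine ⟨ρ'.range, ?_, fun O ↦ ?_⟩
  · rw [← Algebra.map_top]
    exact Algebra.FiniteType.out.map ρ'
  · rw [valuativeLifts_SpecMap_nonempty_iff]
    exact Set.range_subset_iff.symm

end AlgebraicGeometry

/-! ### Affine valuations and properness of the normalization. -/

namespace PointedIntegralScheme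

open IsLocalRing

variable {k K : Type u} [Field k] [Field K] [Algebra k K] (M : PointedIntegralScheme k K)

/-- The embedding of the function field into `K`. -/
noncomputable def functionFieldToField : M.X.functionField ⟶ .of K :=
  CommRingCat.ofHom (M.stalkToField (genericPoint M.X))

/-- The `K`-point of the normalization. -/
noncomputable def normalizationPoint : Spec (.of K) ⟶ M.X.integralNormalization :=
  Spec.map M.functionFieldToField ≫ M.X.toIntegralNormalization

lemma SpecMap_functionFieldToField :
    Spec.map M.functionFieldToField ≫ M.X.fromSpecStalk (genericPoint M.X) = M.η :=
  M.SpecMap_stalkToField_comp_fromSpecStalk _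

lemma normalizationPoint_comp : M.normalizationPoint ≫ M.X.integralNormalizationMap = M.η := by
  rw [normalizationPoint, Category.assoc,
    Scheme.toIntegralNormalization_integralNormalizationMap, SpecMap_functionFieldToField]

lemma normalizationPoint_specializes (x : M.X.integralNormalization) :
    M.normalizationPoint (closedPoint K) ⤳ x := by
  rw [specializes_iff_mem_closure]
  have h := M.X.toIntegralNormalization.denseRange x
  have : Subsingleton (Spec M.X.functionField) :=
    inferInstanceAs (Subsingleton (PrimeSpectrum M.X.functionField))
  have hr : Set.range M.X.toIntegralNormalization = {M.normalizationPoint (closedPoint K)} := by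
    rw [Set.eq_singleton_iff_unique_mem]
    refine ⟨⟨Spec.map M.functionFieldToField (closedPoint K), rfl⟩, ?_⟩
    rintro _ ⟨y, rfl⟩
    exact congr_arg _ (Subsingleton.elim _ _)
  rwa [hr] at h

/-- The normalization map is finite, hence proper, so it does not change the lifts. -/
lemma hasAffineValuations_normalizationPoint_iff :
    HasAffineValuations k M.normalizationPoint ↔ HasAffineValuations k M.η := by
  have := M.X.isFinite_integralNormalizationMap M.str
  rw [← hasAffineValuations_comp_iff k M.normalizationPoint
    (IsProper.valuativeCriterion M.X.integralNormalizationMap), normalizationPoint_comp]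

lemma hasAffineValuations_of_isProperOverAffine
    (h : IsProperOverAffine (M.X.integralNormalizationMap ≫ M.str)) :
    HasAffineValuations k M.η := by
  obtain ⟨Y, s, g, _, _, _, _, hg⟩ := h
  rw [← hasAffineValuations_normalizationPoint_iff, ← hasAffineValuations_comp_iff k _
    (IsProper.valuativeCriterion (g ≫ Y.isoSpec.hom))]
  refine hasAffineValuations_of_Spec _ (Y.isoSpec.inv ≫ s) ?_
  simp [hg, ← M.η_str, ← M.normalizationPoint_comp]

end PointedIntegralScheme

namespace PointedIntegralScheme

open IsLocalRing

variable {k K : Type u} [Field k] [Field K] [Algebra k K] (M : PointedIntegralScheme k K)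

/-- If the valuation rings with a center on `M` all contain `a`, then `a` is integral over the
sections of `M` on affine opens. -/
lemma isIntegralElem_of_forall_mem {a : K}
    (ha : ∀ O : ValuationSubring K, (valuativeLifts M.η O).Nonempty → a ∈ O)
    {U : M.X.Opens} (hU : IsAffineOpen U) [Nonempty U] :
    (M.X.germToFunctionField U ≫ M.functionFieldToField).hom.IsIntegralElem a := by
  let ρ := M.X.germToFunctionField U ≫ M.functionFieldToField
  let : Algebra Γ(M.X, U) K := ρ.hom.toAlgebra
  -- A valuation ring containing the image of the sections on `U` has a center already on `U`, hence
  -- on `M`.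
  refine isIntegral_of_forall_mem_valuationSubring (C := Γ(M.X, U)) fun V hV ↦ ha V ?_
  obtain ⟨g, hg⟩ := (valuativeLifts_SpecMap_nonempty_iff ρ V).mpr hV
  have hη : Spec.map ρ ≫ hU.fromSpec = M.η := by
    rw [← M.SpecMap_functionFieldToField, ← hU.fromSpecStalk_eq_fromSpecStalk
      (((genericPoint_spec M.X).mem_open_set_iff U.isOpen).mpr (by simpa using ‹Nonempty U›)),
      IsAffineOpen.fromSpecStalk, Spec.map_comp, Category.assoc]
  rw [← hη]
  exact ⟨_, comp_mem_valuativeLifts hU.fromSpec hg⟩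

/-- Sections of the normalization that generate the integral closure of the given subalgebra. -/
lemma exists_section_of_forall_mem {a : K}
    (ha : ∀ O : ValuationSubring K, (valuativeLifts M.η O).Nonempty → a ∈ O) :
    letI := M.functionFieldToField.hom.toAlgebra
    IsIntegral M.X.functionField a ∧ ∀ i, ∃ s : Γ(M.X.integralNormalization, ⊤),
      M.X.toIntegralNormalization.appTop s =
        (Scheme.ΓSpecIso M.X.functionField).inv ((minpoly M.X.functionField a).coeff i) := by
  let : Algebra M.X.functionField K := M.functionFieldToField.hom.toAlgebra
  have key (U : M.X.Opens) [Nonempty U] (hU : IsAffineOpen U) :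
      letI := (M.X.germToFunctionField U ≫ M.functionFieldToField).hom.toAlgebra
      IsScalarTower Γ(M.X, U) M.X.functionField K ∧ IsIntegral Γ(M.X, U) a := by
    let := (M.X.germToFunctionField U ≫ M.functionFieldToField).hom.toAlgebra
    exact ⟨.of_algebraMap_eq fun _ ↦ rfl, M.isIntegralElem_of_forall_mem ha hU⟩
  refine ⟨?_, fun i ↦ Scheme.exists_appTop_eq_of_isIntegral _ fun U _ hU ↦ ?_⟩
  · obtain ⟨_, ⟨U, hU, rfl⟩, hxU, -⟩ := M.X.isBasis_affineOpens.exists_subset_of_mem_open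
      (Set.mem_univ (genericPoint M.X)) isOpen_univ
    have : Nonempty U := ⟨⟨_, hxU⟩⟩
    let := (M.X.germToFunctionField U ≫ M.functionFieldToField).hom.toAlgebra
    obtain ⟨_, h⟩ := key U hU
    exact h.tower_top
  · let := (M.X.germToFunctionField U ≫ M.functionFieldToField).hom.toAlgebra
    obtain ⟨_, h⟩ := key U hU
    exact h.coeff_minpoly i

/-- The value at the `K`-point of a global section of the normalization. -/
lemma normalizationPoint_toSpecΓ : M.normalizationPoint ≫ M.X.integralNormalization.toSpecΓ =
    Spec.map (M.X.toIntegralNormalization.appTop ≫ (Scheme.ΓSpecIso M.X.functionField).hom ≫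
      M.functionFieldToField) := by
  rw [normalizationPoint, Category.assoc, Scheme.toSpecΓ_naturality, Spec.map_comp, Spec.map_comp,
    SpecMap_ΓSpecIso_hom, Category.assoc]

/-- The affine target is the spectrum of the algebra generated by the coefficients of the minimal
polynomials of generators of `A`. Over a valuation ring, containing these coefficients forces
containing `A`. -/
lemma isProperOverAffine_of_hasAffineValuations (h : HasAffineValuations k M.η) :
    IsProperOverAffine (M.X.integralNormalizationMap ≫ M.str) := by
  have hN := M.hasAffineValuations_normalizationPoint_iff.mpr h
  have := M.X.isFinite_integralNormalizationMap M.str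
  obtain ⟨-, A, ⟨S, hS⟩, hA⟩ := h
  obtain ⟨hsub, -⟩ := hN
  let N := M.X.integralNormalization
  let p : N ⟶ Spec (.of k) := M.X.integralNormalizationMap ≫ M.str
  let L := M.X.functionField
  let : Algebra L K := M.functionFieldToField.hom.toAlgebra
  have hS' (a : S) : ∀ O : ValuationSubring K, (valuativeLifts M.η O).Nonempty → (a : K) ∈ O :=
    fun O hO ↦ (hA O).mp hO (hS ▸ Algebra.subset_adjoin a.2)
  have hint (a : S) : IsIntegral L (a : K) := (M.exists_section_of_forall_mem (hS' a)).1
  choose σ hσ using fun a : S ↦ (M.exists_section_of_forall_mem (hS' a)).2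
  -- Cutting off above the degree keeps `T` finite; the omitted coefficients are zero.
  let T : Set Γ(N, ⊤) := ⋃ a : S, σ a '' (Finset.range ((minpoly L (a : K)).natDegree + 1))
  have hT : T.Finite := Set.finite_iUnion fun a ↦ (Finset.finite_toSet _).image _
  let κ : CommRingCat.of k ⟶ Γ(N, ⊤) := (Scheme.ΓSpecIso _).inv ≫ p.appTop
  let : Algebra k Γ(N, ⊤) := κ.hom.toAlgebra
  let B : Subalgebra k Γ(N, ⊤) := Algebra.adjoin k T
  let g : N ⟶ Spec (.of B) := N.toSpecΓ ≫ Spec.map (CommRingCat.ofHom B.val.toRingHom)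
  let s : Spec (.of B) ⟶ Spec (.of k) := Spec.map (CommRingCat.ofHom (algebraMap k B))
  have hgs : g ≫ s = p := by
    rw [Category.assoc, ← Spec.map_comp]
    change N.toSpecΓ ≫ Spec.map κ = p
    rw [Spec.map_comp, ← Scheme.toSpecΓ_naturality_assoc, ← SpecMap_ΓSpecIso_hom, ← Spec.map_comp,
      Iso.inv_hom_id, Spec.map_id, Category.comp_id]
  have hs : LocallyOfFiniteType s := by
    rw [HasRingHomProperty.Spec_iff (P := @LocallyOfFiniteType)]
    have : Algebra.FiniteType k B := B.fg_iff_finiteType.mp (Subalgebra.fg_def.mpr ⟨T, hT, rfl⟩)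
    exact RingHom.finiteType_algebraMap.mpr this
  have : LocallyOfFiniteType (g ≫ s) := hgs ▸ inferInstanceAs (LocallyOfFiniteType p)
  have : LocallyOfFiniteType g := locallyOfFiniteType_of_comp g s
  have : QuasiCompact (g ≫ s) := hgs ▸ inferInstanceAs (QuasiCompact p)
  have : QuasiCompact g := .of_comp g s
  -- This supplies the quasi-separatedness of `g` that the valuative criterion for properness
  -- presupposes.
  have : IsLocallyNoetherian N := LocallyOfFiniteType.isLocallyNoetherian p
  have : QuasiSeparated g := inferInstance
  refine ⟨Spec (.of B), s, g, inferInstance, hs, inferInstance, ?_, hgs⟩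
  refine IsProper.of_valuativeCriterion g (.of_generic g M.normalizationPoint
    M.normalizationPoint_specializes fun O hO ↦ ?_)
  have hlift : (valuativeLifts M.normalizationPoint O).Nonempty := by
    rw [← valuativeLifts_comp_nonempty_iff _ _
      (IsProper.valuativeCriterion M.X.integralNormalizationMap), M.normalizationPoint_comp, hA O,
      ← hS]
    have hk (c : k) : algebraMap k K c ∈ O := by
      obtain ⟨l, hl⟩ := hO
      refine algebraMap_mem_of_mem_valuativeLifts s ?_ hl c
      rw [Category.assoc, hgs, ← Category.assoc, M.normalizationPoint_comp, M.η_str]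
    have hB (b : B) : M.functionFieldToField ((Scheme.ΓSpecIso L).hom
        (M.X.toIntegralNormalization.appTop b.1)) ∈ O := by
      have hg : M.normalizationPoint ≫ g = Spec.map (CommRingCat.ofHom B.val.toRingHom ≫
          M.X.toIntegralNormalization.appTop ≫ (Scheme.ΓSpecIso L).hom ≫
            M.functionFieldToField) := by
        rw [Spec.map_comp, ← normalizationPoint_toSpecΓ, Category.assoc]
      rw [hg, valuativeLifts_SpecMap_nonempty_iff] at hO
      exact hO b
    let OA : Subalgebra k K := { O.toSubring with algebraMap_mem' := hk }
    change (Algebra.adjoin k (S : Set K)) ≤ OA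
    refine Algebra.adjoin_le fun a ha ↦ O.mem_of_coeff_minpoly_mem (hint ⟨a, ha⟩) fun i ↦ ?_
    by_cases hi : i < (minpoly L a).natDegree + 1
    · have hmem : σ ⟨a, ha⟩ i ∈ B := Algebra.subset_adjoin (Set.mem_iUnion.mpr
        ⟨⟨a, ha⟩, i, by simpa using hi, rfl⟩)
      have := hB ⟨_, hmem⟩
      rw [hσ, Iso.inv_hom_id_apply] at this
      exact this
    · have hi' : (minpoly L a).natDegree < i := by omega
      change algebraMap L K ((minpoly L a).coeff i) ∈ O
      rw [Polynomial.coeff_eq_zero_of_natDegree_lt hi', map_zero]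
      exact O.zero_mem
  obtain ⟨l, hl⟩ := hlift
  exact ⟨l, (hsub O).eq_singleton_of_mem hl⟩

theorem hasAffineValuations_iff_isProperOverAffine :
    HasAffineValuations k M.η ↔
      IsProperOverAffine (M.X.integralNormalizationMap ≫ M.str) :=
  ⟨M.isProperOverAffine_of_hasAffineValuations, M.hasAffineValuations_of_isProperOverAffine⟩

end PointedIntegralScheme

theorem mainTheorem9 (k : Type u) [Field k] :
    (∀ (K : Type u) [Field K] [Algebra k K] (B : BirationalSpace.{u, v} k K)
        (M : PointedIntegralScheme k K), M.IsModelOf B →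
        (B.IsAffine ↔ IsProperOverAffine (M.X.integralNormalizationMap ≫ M.str))) ∧
    (∀ (S S' : Scheme.{u}) (s : S ⟶ Spec (.of k)) (s' : S' ⟶ Spec (.of k))
        [IsIntegral S] [IsIntegral S']
        [LocallyOfFiniteType s] [QuasiCompact s] [LocallyOfFiniteType s'] [QuasiCompact s']
        (π : S' ⟶ S) [IsProper π] [Surjective π], π ≫ s = s' →
        (IsProperOverAffine (S'.integralNormalizationMap ≫ s') ↔
          IsProperOverAffine (S.integralNormalizationMap ≫ s))) := by
  refine ⟨fun K _ _ B M h ↦ h.isAffine_iff.trans M.hasAffineValuations_iff_isProperOverAffine, ?_⟩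
  intro S S' s s' _ _ _ _ _ _ π _ _ hπ
  -- Both schemes are pointed by the same field. It may be strictly larger than the function field
  -- of `S`, which is why part 1 is needed for general `K`.
  let K := S'.functionField
  let η : Spec (.of K) ⟶ S' := S'.fromSpecStalk (genericPoint S')
  obtain ⟨κ, hκ⟩ := Spec.map_surjective (η ≫ s')
  let : Algebra k K := κ.hom.toAlgebra
  have hη : η (IsLocalRing.closedPoint K) = genericPoint S' := Scheme.fromSpecStalk_closedPoint
  have hgen : π (genericPoint S') = genericPoint S := by
    refine IsGenericPoint.eq ?_ (genericPoint_spec S)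
    have := (genericPoint_spec S').image π.continuous
    rwa [Set.image_univ, π.surjective.range_eq, closure_univ] at this
  let M' : PointedIntegralScheme k K := ⟨S', s', η, hκ.symm, hη⟩
  let M : PointedIntegralScheme k K := ⟨S, s, η ≫ π, by rw [Category.assoc, hπ]; exact hκ.symm,
    (congr_arg π hη).trans hgen⟩
  exact (M'.hasAffineValuations_iff_isProperOverAffine).symm.trans
    ((hasAffineValuations_comp_iff k η (IsProper.valuativeCriterion π)).symm.trans
      M.hasAffineValuations_iff_isProperOverAffine)
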